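/- **Setting.** An arm with $n$ states is a Markov decision process with state space $[n]=\{1,\dots,n\}$, actions $a\in\{0,1\}$ ($0$ = rest, $1$ = activate), rewards $r^a_i\in\mathbb R$ and stochastic transition matrices $P^a$. A policy is a set $\pi\subseteq[n]$ of active states; write $\pi_i=1$ if $i\in\pi$ and $\pi_i=0$ otherwise, and $P^\pi_{ij}=P^{\pi_i}_{ij}$. A policy is unichain if $P^\pi$ has exactly one recurrent class, and multichain otherwise; the arm is unichain if every policy is unichain. For $\lambda\in\mathbb R$, the $\lambda$-penalized arm has rewards $r^a_i-\lambda a$. Its optimal gain $g^*(\lambda)$ is the maximum over all policies of the long-term average expected reward (for a unichain arm it does not depend on the initial state). A policy $\pi$ is Bellman optimal for $\lambda$ if there is $h\in\mathbb R^n$ such that, for all $i$, $$g^*(\lambda)+h_i=\max_{a\in\{0,1\}}\Big(r^a_i-\lambda a+\sum_j P^a_{ij}h_j\Big)$$ and $a=\pi_i$ attains this maximum. The arm is indexable if for all $\lambda<\lambda'$, every policy $\pi$ that is Bellman optimal for $\lambda$ and every policy $\pi'$ that is Bellman optimal for $\lambda'$ satisfy $\pi\supseteq\pi'$. For a unichain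 policy $\pi$, the active advantage is $\alpha^\pi_i(\lambda)=r^1_i-r^0_i-\lambda+\sum_j(P^1_{ij}-P^0_{ij})h_j$, where $h$ is any solution, for some $g\in\mathbb R$, of $g+h_i=r^{\pi_i}_i-\lambda\pi_i+\sum_jP^{\pi_i}_{ij}h_j$ for all $i$ ($h$ exists and is unique up to an additive constant); $\alpha^\pi_i(+\infty)$ denotes the limit in $[-\infty,+\infty]$ of the affine function $\alpha_i^\pi$ at $+\infty$. **Algorithm 1.** Set $\pi^1=[n]$ and $\mu^0=-\infty$. If $\pi^1$ is multichain, return "the arm is multichain". For $k=1,\dots,n$: 1. let $\mu^k=\inf\{\lambda\in\mathbb R:\lambda\ge\mu^{k-1},\ \exists i\in\pi^k,\ \alpha^{\pi^k}_i(\lambda)=0\}$ (with $\inf\emptyset=+\infty$); 2. if $\mu^{k-1}<\mu^k$ and $\alpha^{\pi^k}_i(\mu^k)\ge0$ for some $i\notin\pi^k$, return "the arm is not indexable"; 3. if $\mu^k=+\infty$, set $\lambda_i=+\infty$ for all $i\in\pi^k$ and return "the arm is indexable and the indices are $(\lambda_i)_{i\in[n]}$"; 4. choose any $\sigma^k\in\pi^k$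 with $\alpha^{\pi^k}_{\sigma^k}(\mu^k)=0$, set $\lambda_{\sigma^k}=\mu^k$ and $\pi^{k+1}=\pi^k\setminus\{\sigma^k\}$; if $\pi^{k+1}$ is multichain, return "the arm is multichain". After the loop, return "the arm is indexable and the indices are $(\lambda_i)_{i\in[n]}$". **Corollary 1.** Given a unichain arm with finitely many states, and whatever choices of the $\sigma^k$ are made, Algorithm 1 outputs "the arm is indexable" (with some indices) if and only if the arm is indexable; and it never outputs "the arm is multichain". -/

import Mathlib

/-- A restless bandit arm: a Markov decision process with state space `Fin n` and actions
`0` (rest) and `1` (activate). `r a i` is the reward and `P a i j` the probability of moving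
from `i` to `j` when action `a` is taken in state `i`. -/
structure Arm (n : ℕ) where
  r : Fin 2 → Fin n → ℝ
  P : Fin 2 → Matrix (Fin n) (Fin n) ℝ
  P_nonneg : ∀ a i j, 0 ≤ P a i j
  P_sum : ∀ a i, ∑ j, P a i j = 1

/-- State `j` is accessible from state `i` in the Markov chain with transition matrix `M`. -/
def Accessible {n : ℕ} (M : Matrix (Fin n) (Fin n) ℝ) (i j : Fin n) : Prop :=
  ∃ t : ℕ, 0 < (M ^ t) i j

/-- A recurrent class of a finite Markov chain: a nonempty set of states that is closed and all
of whose states communicate, i.e. that is the set of states accessible from any of its members. -/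
def IsRecurrentClass {n : ℕ} (M : Matrix (Fin n) (Fin n) ℝ) (C : Set (Fin n)) : Prop :=
  C.Nonempty ∧ ∀ i ∈ C, ∀ j, j ∈ C ↔ Accessible M i j

namespace Arm

variable {n : ℕ}

/-- The action chosen in state `i` by the policy whose set of active states is `π`. -/
def act (π : Finset (Fin n)) (i : Fin n) : Fin 2 := if i ∈ π then 1 else 0

/-- The reward of action `a` in state `i` in the `lam`-penalized arm. -/
def reward (A : Arm n) (lam : ℝ) (a : Fin 2) (i : Fin n) : ℝ :=
  A.r a i - lam * ((a : ℕ) : ℝ)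

/-- The transition matrix of the Markov chain induced by the policy `π`. -/
def trans (A : Arm n) (π : Finset (Fin n)) : Matrix (Fin n) (Fin n) ℝ :=
  fun i j => A.P (act π i) i j

/-- The policy `π` is unichain. A policy that is not unichain is multichain. -/
def UnichainPolicy (A : Arm n) (π : Finset (Fin n)) : Prop :=
  ∃! C : Set (Fin n), IsRecurrentClass (A.trans π) C

/-- The arm is unichain. -/
def Unichain (A : Arm n) : Prop := ∀ π : Finset (Fin n), A.UnichainPolicy π

/-- In the `lam`-penalized arm, `x` is the gain (long-term average expected reward) of the
policy `π` from the initial state `i`. -/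
def HasGain (A : Arm n) (lam : ℝ) (π : Finset (Fin n)) (i : Fin n) (x : ℝ) : Prop :=
  Filter.Tendsto
    (fun T : ℕ => (∑ t ∈ Finset.range T,
      ((A.trans π ^ t).mulVec fun j => A.reward lam (act π j) j) i) / (T : ℝ))
    Filter.atTop (nhds x)

/-- `g` is the maximal gain over all policies, from every initial state. -/
def IsOptimalGain (A : Arm n) (lam g : ℝ) : Prop :=
  ∀ i, IsGreatest {x | ∃ π : Finset (Fin n), A.HasGain lam π i x} g

/-- The right-hand side of the Bellman equation for action `a` in state `i`. -/
def actionValue (A : Arm n) (lam : ℝ) (h : Fin n → ℝ) (a : Fin 2) (i : Fin n) : ℝ :=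
  A.reward lam a i + ∑ j, A.P a i j * h j

/-- The policy `π` is Bellman optimal for the penalty `lam`: with `g` the optimal gain, some
solution `h` of the Bellman optimality equation is such that `π` attains all the maxima. -/
def BellmanOptimal (A : Arm n) (lam : ℝ) (π : Finset (Fin n)) : Prop :=
  ∃ (g : ℝ) (h : Fin n → ℝ), A.IsOptimalGain lam g ∧
    (∀ i, g + h i = max (A.actionValue lam h 0 i) (A.actionValue lam h 1 i)) ∧
    ∀ i, A.actionValue lam h (act π i) i
      = max (A.actionValue lam h 0 i) (A.actionValue lam h 1 i)

/-- The arm is indexable. -/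
def Indexable (A : Arm n) : Prop :=
  ∀ lam lam' : ℝ, lam < lam' → ∀ π π' : Finset (Fin n),
    A.BellmanOptimal lam π → A.BellmanOptimal lam' π' → π' ⊆ π

/-- `h` is a bias vector of the policy `π` for the penalty `lam`. -/
def IsBias (A : Arm n) (lam : ℝ) (π : Finset (Fin n)) (h : Fin n → ℝ) : Prop :=
  ∃ g : ℝ, ∀ i, g + h i = A.actionValue lam h (act π i) i

/-- A bias vector of the policy `π`. For a unichain policy there is one, and it is unique up to
an additive constant. -/
noncomputable def bias (A : Arm n) (π : Finset (Fin n)) (lam : ℝ) : Fin n → ℝ :=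
  Classical.epsilon fun h => A.IsBias lam π h

/-- The active advantage of state `i` under the policy `π` for the penalty `lam`. For a unichain
policy it does not depend on the choice of the bias vector. -/
noncomputable def adv (A : Arm n) (π : Finset (Fin n)) (i : Fin n) (lam : ℝ) : ℝ :=
  A.r 1 i - A.r 0 i - lam + ∑ j, (A.P 1 i j - A.P 0 i j) * A.bias π lam j

/-- The active advantage as a function of an extended penalty: at `±∞` it is the limit, which
exists in `[-∞, +∞]` for a unichain policy since the active advantage is then affine. -/
noncomputable def advE (A : Arm n) (π : Finset (Fin n)) (i : Fin n) : EReal → EReal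
  | ⊤ => Filter.limUnder Filter.atTop fun lam : ℝ => (A.adv π i lam : EReal)
  | ⊥ => Filter.limUnder Filter.atBot fun lam : ℝ => (A.adv π i lam : EReal)
  | (lam : ℝ) => (A.adv π i lam : EReal)

/-- The smallest penalty at or above `μ` at which the active advantage of some active state
vanishes (`+∞` if there is none). -/
noncomputable def nextPenalty (A : Arm n) (π : Finset (Fin n)) (μ : EReal) : EReal :=
  sInf {x : EReal | ∃ lam : ℝ, x = lam ∧ μ ≤ lam ∧ ∃ i ∈ π, A.adv π i lam = 0}

/-- The possible outputs of the algorithm. -/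
inductive Output (n : ℕ) where
  | multichain : Output n
  | notIndexable : Output n
  | indexable (index : Fin n → EReal) : Output n

open Classical in
/-- The main loop. The arguments are the number of iterations left, and, at the start of
iteration `k`, the policy `π^k`, the penalty `μ^{k-1}` and the indices assigned so far.
The function `choice` resolves the choice of the state that is removed from the policy among
the active states whose active advantage vanishes at `μ^k`. -/
noncomputable def loop (A : Arm n) (choice : Finset (Fin n) → Fin n) :
    ℕ → Finset (Fin n) → EReal → (Fin n → EReal) → Output n
  | 0, _, _, index => .indexable index
  | m + 1, π, μ, index =>
    let μ' := A.nextPenalty π μ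
    if μ < μ' ∧ ∃ i, i ∉ π ∧ 0 ≤ A.advE π i μ' then .notIndexable
    else if μ' = ⊤ then .indexable fun i => if i ∈ π then ⊤ else index i
    else
      let σ := choice (π.filter fun i => A.advE π i μ' = 0)
      let π' := π.erase σ
      if ¬ A.UnichainPolicy π' then .multichain
      else loop A choice m π' μ' (Function.update index σ μ')

open Classical in
/-- The algorithm. The initial value of the indices is a placeholder. -/
noncomputable def algorithm (A : Arm n) (choice : Finset (Fin n) → Fin n) : Output n :=
  if ¬ A.UnichainPolicy Finset.univ then .multichain
  else loop A choice n Finset.univ ⊥ fun _ => ⊥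

end Arm

/-!
A unichain arm obeys a two-sided comparison principle: if in every state some action keeps `d`
from decreasing in mean and some action keeps it from increasing, up to a common drift, then `d`
is constant. Applied to the difference of two bias vectors, it shows that two policies have the
same active advantages as soon as these have opposite signs wherever the policies differ. So all
optimal policies for a given penalty share their active advantages, and the arm is indexable if
and only if, as the penalty grows, this optimal advantage changes sign at most once in each state,
from positive to negative, and vanishes at most once.

The algorithm traces the optimal advantages from `-∞` upwards. On `[μ^{k-1}, μ^k]` the policy `π^k`
stays optimal unless a passive state is about to become active again; the test detects this, and
the arm is then not indexable. Otherwise, when no active state is left, every state has changed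
sign exactly once. The initial penalty `-∞` may be replaced by any real one below which every
active advantage under permanent activation is positive.
-/

section StochasticMatrix

open Matrix

variable {ι : Type*}

/-- The Markov chain with transition matrix `M` never leaves the set of states `C`. -/
def IsClosedClass (M : Matrix ι ι ℝ) (C : Set ι) : Prop :=
  ∀ i ∈ C, ∀ j, 0 < M i j → j ∈ C

variable [Fintype ι] [DecidableEq ι] {M : Matrix ι ι ℝ} {d v w : ι → ℝ} {c g δ : ℝ}

theorem mulVec_const_of_mem_rowStochastic (hM : M ∈ rowStochastic ℝ ι) (c : ℝ) :
    (M *ᵥ fun _ => c) = fun _ => c := by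
  ext i
  simp only [mulVec, dotProduct, ← Finset.sum_mul, sum_row_of_mem_rowStochastic hM i, one_mul]

theorem mulVec_le_mulVec_of_mem_rowStochastic (hM : M ∈ rowStochastic ℝ ι) (h : v ≤ w) :
    M *ᵥ v ≤ M *ᵥ w :=
  fun i => dotProduct_le_dotProduct_of_nonneg_left h (hM.1 i)

theorem mulVec_le_of_mem_rowStochastic (hM : M ∈ rowStochastic ℝ ι) (hd : ∀ j, d j ≤ c) (i : ι) :
    (M *ᵥ d) i ≤ c :=
  (mulVec_le_mulVec_of_mem_rowStochastic hM hd i).trans_eq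
    (congrFun (mulVec_const_of_mem_rowStochastic hM c) i)

theorem abs_mulVec_le_of_mem_rowStochastic (hM : M ∈ rowStochastic ℝ ι) (hd : ∀ j, |d j| ≤ c)
    (i : ι) : |(M *ᵥ d) i| ≤ c := by
  refine abs_le'.2 ⟨mulVec_le_of_mem_rowStochastic hM (fun j => (abs_le'.1 (hd j)).1) i, ?_⟩
  rw [← Pi.neg_apply, ← mulVec_neg]
  exact mulVec_le_of_mem_rowStochastic hM (fun j => (abs_le'.1 (hd j)).2) i

theorem eq_of_le_mulVec (hM : M ∈ rowStochastic ℝ ι) (hd : ∀ j, d j ≤ c) {i j : ι}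
    (h : c ≤ (M *ᵥ d) i) (hij : 0 < M i j) : d j = c := by
  have hterm : ∀ k ∈ Finset.univ, M i k * d k ≤ M i k * c := fun k _ =>
    mul_le_mul_of_nonneg_left (hd k) (nonneg_of_mem_rowStochastic hM)
  have hsum : ∑ k, M i k * d k = ∑ k, M i k * c := by
    refine le_antisymm (Finset.sum_le_sum hterm) ?_
    rwa [← Finset.sum_mul, sum_row_of_mem_rowStochastic hM, one_mul]
  exact mul_left_cancel₀ hij.ne'
    ((Finset.sum_eq_sum_iff_of_le hterm).1 hsum j (Finset.mem_univ j))

theorem isClosedClass_setOf_forall_le (hM : M ∈ rowStochastic ℝ ι)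
    (h : ∀ i, (∀ j, d j ≤ d i) → d i ≤ (M *ᵥ d) i) : IsClosedClass M {i | ∀ j, d j ≤ d i} :=
  fun i hi _ hij k => (hi k).trans_eq (eq_of_le_mulVec hM hi (h i hi) hij).symm

theorem isClosedClass_setOf_forall_ge (hM : M ∈ rowStochastic ℝ ι)
    (h : ∀ i, (∀ j, d i ≤ d j) → (M *ᵥ d) i ≤ d i) : IsClosedClass M {i | ∀ j, d i ≤ d j} := by
  simpa [mulVec_neg] using isClosedClass_setOf_forall_le (d := -d) hM (by simpa [mulVec_neg])

theorem nonpos_of_add_le_mulVec [Nonempty ι] (hM : M ∈ rowStochastic ℝ ι)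
    (h : ∀ i, δ + d i ≤ (M *ᵥ d) i) : δ ≤ 0 := by
  obtain ⟨i, hi⟩ := Finite.exists_max d
  linarith [h i, mulVec_le_of_mem_rowStochastic hM hi i]

/- With `v = g + h - M h`, the sum of the first `T` terms telescopes to `T g + h - M ^ T h`, and
`M ^ T h` stays bounded. -/
theorem tendsto_average_of_poisson (hM : M ∈ rowStochastic ℝ ι) {h : ι → ℝ}
    (hv : ∀ i, g + h i = v i + (M *ᵥ h) i) (i : ι) :
    Filter.Tendsto (fun T : ℕ => (∑ t ∈ Finset.range T, ((M ^ t) *ᵥ v) i) / (T : ℝ))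
      Filter.atTop (nhds g) := by
  have hterm (t : ℕ) : ((M ^ t) *ᵥ v) i = g + (((M ^ t) *ᵥ h) i - ((M ^ (t + 1)) *ᵥ h) i) := by
    have hv' : v = (fun _ => g) + h - M *ᵥ h := by
      ext k
      simp only [Pi.sub_apply, Pi.add_apply]
      linarith [hv k]
    rw [hv', mulVec_sub, mulVec_add, mulVec_mulVec, ← pow_succ,
      mulVec_const_of_mem_rowStochastic (pow_mem hM t)]
    simp only [Pi.sub_apply, Pi.add_apply]
    ring
  have hsum (T : ℕ) :
      ∑ t ∈ Finset.range T, ((M ^ t) *ᵥ v) i = T * g + (h i - ((M ^ T) *ᵥ h) i) := by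
    simp only [hterm, Finset.sum_add_distrib, Finset.sum_range_sub', Finset.sum_const,
      Finset.card_range, nsmul_eq_mul, pow_zero, one_mulVec]
  have hbound (T : ℕ) : ‖h i - ((M ^ T) *ᵥ h) i‖ ≤ ‖h‖ + ‖h‖ :=
    (norm_sub_le _ _).trans (add_le_add (norm_le_pi_norm h i)
      (abs_mulVec_le_of_mem_rowStochastic (pow_mem hM T) (norm_le_pi_norm h) i))
  have hlim : Filter.Tendsto (fun T : ℕ => (h i - ((M ^ T) *ᵥ h) i) / (T : ℝ))
      Filter.atTop (nhds 0) := by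
    refine squeeze_zero_norm (fun T => ?_)
      (tendsto_const_div_atTop_nhds_zero_nat (‖h‖ + ‖h‖))
    rw [norm_div, RCLike.norm_natCast]
    gcongr
    exact hbound T
  have hlim' := hlim.const_add g
  rw [add_zero] at hlim'
  refine hlim'.congr' ?_
  filter_upwards [Filter.eventually_ne_atTop 0] with T hT
  rw [hsum, add_div, mul_div_cancel_left₀ g (Nat.cast_ne_zero.2 hT)]

end StochasticMatrix

section RecurrentClass

open Matrix

variable {n : ℕ} {M : Matrix (Fin n) (Fin n) ℝ} {C D : Set (Fin n)} {d : Fin n → ℝ} {δ : ℝ}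

theorem pow_succ_apply_pos_iff (hM : M ∈ rowStochastic ℝ (Fin n)) (t : ℕ) {i j : Fin n} :
    0 < (M ^ (t + 1)) i j ↔ ∃ k, 0 < (M ^ t) i k ∧ 0 < M k j := by
  have hpow (k : Fin n) : 0 ≤ (M ^ t) i k := (pow_mem hM t).1 i k
  rw [pow_succ, mul_apply,
    Finset.sum_pos_iff_of_nonneg fun k _ => mul_nonneg (hpow k) (hM.1 k j)]
  refine ⟨fun ⟨k, _, hk⟩ => ⟨k, ?_, ?_⟩, fun ⟨k, hik, hkj⟩ => ⟨k, by simp, mul_pos hik hkj⟩⟩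
  · exact pos_of_mul_pos_left hk (hM.1 k j)
  · exact pos_of_mul_pos_right hk (hpow k)

theorem accessible_iff_reflTransGen (hM : M ∈ rowStochastic ℝ (Fin n)) {i j : Fin n} :
    Accessible M i j ↔ Relation.ReflTransGen (fun k l => 0 < M k l) i j := by
  constructor
  · rintro ⟨t, ht⟩
    induction t generalizing j with
    | zero =>
      obtain rfl : i = j := by
        by_contra hij
        simp [one_apply_ne hij] at ht
      exact .refl
    | succ t ih =>
      obtain ⟨k, hik, hkj⟩ := (pow_succ_apply_pos_iff hM t).1 ht
      exact (ih hik).tail hkj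
  · intro h
    induction h with
    | refl => exact ⟨0, by simp⟩
    | tail _ hkl ih =>
      obtain ⟨t, ht⟩ := ih
      exact ⟨t + 1, (pow_succ_apply_pos_iff hM t).2 ⟨_, ht, hkl⟩⟩

theorem IsClosedClass.mem_of_accessible (hC : IsClosedClass M C)
    (hM : M ∈ rowStochastic ℝ (Fin n)) {i j : Fin n} (hi : i ∈ C) (hij : Accessible M i j) :
    j ∈ C := by
  rw [accessible_iff_reflTransGen hM] at hij
  induction hij with
  | refl => exact hi
  | tail _ hkl ih => exact hC _ ih _ hkl

theorem isClosedClass_setOf_accessible (hM : M ∈ rowStochastic ℝ (Fin n)) (i : Fin n) :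
    IsClosedClass M {j | Accessible M i j} := by
  simp only [accessible_iff_reflTransGen hM]
  exact fun j hj k hjk => hj.tail hjk

/- A minimal nonempty closed class is recurrent: the states accessible from one of its members form
a nonempty closed class inside it. -/
theorem IsClosedClass.exists_isRecurrentClass_subset (hC : IsClosedClass M C)
    (hM : M ∈ rowStochastic ℝ (Fin n)) (hne : C.Nonempty) :
    ∃ D ⊆ C, IsRecurrentClass M D := by
  obtain ⟨D, hDC, ⟨hD, hDne⟩, hmin⟩ := exists_minimal_le_of_wellFoundedLT
    (fun D : Set (Fin n) => IsClosedClass M D ∧ D.Nonempty) C ⟨hC, hne⟩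
  refine ⟨D, hDC, hDne, fun i hi j => ⟨fun hj => ?_, hD.mem_of_accessible hM hi⟩⟩
  exact hmin ⟨isClosedClass_setOf_accessible hM i, i, 0, by simp⟩
    (fun k hk => hD.mem_of_accessible hM hi hk) hj

theorem IsClosedClass.inter_nonempty (hC : IsClosedClass M C) (hD : IsClosedClass M D)
    (hM : M ∈ rowStochastic ℝ (Fin n)) (hu : ∃! E, IsRecurrentClass M E) (hCne : C.Nonempty)
    (hDne : D.Nonempty) : (C ∩ D).Nonempty := by
  obtain ⟨C', hC'C, hC'⟩ := hC.exists_isRecurrentClass_subset hM hCne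
  obtain ⟨D', hD'D, hD'⟩ := hD.exists_isRecurrentClass_subset hM hDne
  obtain rfl := hu.unique hC' hD'
  exact hC'.1.mono (Set.subset_inter hC'C hD'D)

theorem nonempty_of_existsUnique_isRecurrentClass (hu : ∃! E, IsRecurrentClass M E) :
    Nonempty (Fin n) :=
  have ⟨_, hE⟩ := hu.exists
  hE.1.to_type

theorem const_of_existsUnique_isRecurrentClass (hM : M ∈ rowStochastic ℝ (Fin n))
    (hu : ∃! E, IsRecurrentClass M E) (hmax : ∀ i, (∀ j, d j ≤ d i) → d i ≤ (M *ᵥ d) i)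
    (hmin : ∀ i, (∀ j, d i ≤ d j) → (M *ᵥ d) i ≤ d i) (i j : Fin n) : d i = d j := by
  have := nonempty_of_existsUnique_isRecurrentClass hu
  obtain ⟨x, hx, hx'⟩ := (isClosedClass_setOf_forall_le hM hmax).inter_nonempty
    (isClosedClass_setOf_forall_ge hM hmin) hM hu (Finite.exists_max d) (Finite.exists_min d)
  exact (le_antisymm (hx i) (hx' i)).trans (le_antisymm (hx j) (hx' j)).symm

theorem eq_zero_and_const_of_add_eq_mulVec (hM : M ∈ rowStochastic ℝ (Fin n))
    (hu : ∃! E, IsRecurrentClass M E) (h : ∀ i, δ + d i = (M *ᵥ d) i) :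
    δ = 0 ∧ ∀ i j, d i = d j := by
  have := nonempty_of_existsUnique_isRecurrentClass hu
  have hle : δ ≤ 0 := nonpos_of_add_le_mulVec hM fun i => (h i).le
  have hge : -δ ≤ 0 := nonpos_of_add_le_mulVec (d := -d) hM fun i => by
    simp only [mulVec_neg, Pi.neg_apply, ← h i]
    linarith
  exact ⟨by linarith, const_of_existsUnique_isRecurrentClass hM hu
    (fun i _ => by linarith [h i]) fun i _ => by linarith [h i]⟩

/- Normalizing `g = h x` at a state `x` makes the equation a square linear system, which is
injective by uniqueness. -/
theorem exists_poisson (hM : M ∈ rowStochastic ℝ (Fin n)) (hu : ∃! E, IsRecurrentClass M E)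
    (v : Fin n → ℝ) : ∃ (g : ℝ) (h : Fin n → ℝ), ∀ i, g + h i = v i + (M *ᵥ h) i := by
  obtain ⟨x⟩ := nonempty_of_existsUnique_isRecurrentClass hu
  let T : (Fin n → ℝ) →ₗ[ℝ] (Fin n → ℝ) :=
    (LinearMap.proj x).smulRight 1 + LinearMap.id - M.mulVecLin
  have hT (h : Fin n → ℝ) (i : Fin n) : T h i = h x + h i - (M *ᵥ h) i := by simp [T]
  have hinj : Function.Injective T := by
    rw [injective_iff_map_eq_zero]
    intro h hh
    obtain ⟨hx, hconst⟩ := eq_zero_and_const_of_add_eq_mulVec (δ := h x) hM hu fun i =>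
      sub_eq_zero.1 ((hT h i).symm.trans (congrFun hh i))
    exact funext fun i => (hconst i x).trans hx
  obtain ⟨h, hh⟩ := LinearMap.injective_iff_surjective.1 hinj v
  exact ⟨h x, h, fun i => by linarith [hT h i, congrFun hh i]⟩

end RecurrentClass

namespace Arm

open Matrix Set

variable {n : ℕ} {A : Arm n} {π ρ : Finset (Fin n)} {lam μ ν : ℝ} {h h' : Fin n → ℝ}
  {i s : Fin n}

theorem act_of_mem (hi : i ∈ π) : act π i = 1 := if_pos hi

theorem act_of_notMem (hi : i ∉ π) : act π i = 0 := if_neg hi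

theorem exists_act_eq (a : Fin n → Fin 2) : ∃ π : Finset (Fin n), ∀ i, act π i = a i := by
  refine ⟨Finset.univ.filter fun i => a i = 1, fun i => ?_⟩
  by_cases hi : a i = 1
  · rw [act_of_mem (by simpa using hi), hi]
  · rw [act_of_notMem (by simpa using hi)]
    omega

theorem P_mem_rowStochastic (A : Arm n) (a : Fin 2) : A.P a ∈ rowStochastic ℝ (Fin n) :=
  mem_rowStochastic_iff_sum.2 ⟨A.P_nonneg a, A.P_sum a⟩

theorem trans_mem_rowStochastic (A : Arm n) (π : Finset (Fin n)) :
    A.trans π ∈ rowStochastic ℝ (Fin n) :=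
  mem_rowStochastic_iff_sum.2 ⟨fun i => A.P_nonneg (act π i) i, fun i => A.P_sum (act π i) i⟩

theorem trans_mulVec_apply (A : Arm n) (π : Finset (Fin n)) (d : Fin n → ℝ) (i : Fin n) :
    (A.trans π *ᵥ d) i = (A.P (act π i) *ᵥ d) i :=
  rfl

theorem Unichain.nonempty (hA : A.Unichain) : Nonempty (Fin n) :=
  nonempty_of_existsUnique_isRecurrentClass (hA ∅)

/- The policy that takes the action of `hle` where `d` is maximal and that of `hge` elsewhere
induces a chain to which the maximum principle of `const_of_existsUnique_isRecurrentClass`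
applies. -/
theorem Unichain.const_of_add_le_of_le_add (hA : A.Unichain) {δ : ℝ} {d : Fin n → ℝ}
    (hle : ∀ i, ∃ a, δ + d i ≤ (A.P a *ᵥ d) i) (hge : ∀ i, ∃ a, (A.P a *ᵥ d) i ≤ δ + d i)
    (i j : Fin n) : d i = d j := by
  classical
  have := hA.nonempty
  choose a ha using hle
  choose b hb using hge
  obtain rfl : δ = 0 := by
    obtain ⟨πa, hπa⟩ := exists_act_eq a
    obtain ⟨πb, hπb⟩ := exists_act_eq b
    have hnonpos : δ ≤ 0 := nonpos_of_add_le_mulVec (A.trans_mem_rowStochastic πa) fun i => by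
      rw [trans_mulVec_apply, hπa]
      exact ha i
    have hnonneg : -δ ≤ 0 :=
      nonpos_of_add_le_mulVec (d := -d) (A.trans_mem_rowStochastic πb) fun i => by
        rw [trans_mulVec_apply, hπb, mulVec_neg, Pi.neg_apply, Pi.neg_apply]
        linarith [hb i]
    linarith
  obtain ⟨π, hπ⟩ := exists_act_eq fun i => if ∀ j, d j ≤ d i then a i else b i
  refine const_of_existsUnique_isRecurrentClass (A.trans_mem_rowStochastic π) (hA π)
    (fun i hi => ?_) (fun i _ => ?_) i j
  · rw [trans_mulVec_apply, hπ, if_pos hi]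
    linarith [ha i]
  · by_cases hi' : ∀ j, d j ≤ d i
    · exact mulVec_le_of_mem_rowStochastic (A.trans_mem_rowStochastic π) hi' i
    · rw [trans_mulVec_apply, hπ, if_neg hi']
      linarith [hb i]

theorem actionValue_sub_actionValue (A : Arm n) (lam : ℝ) (h h' : Fin n → ℝ) (a : Fin 2)
    (i : Fin n) : A.actionValue lam h a i - A.actionValue lam h' a i = (A.P a *ᵥ (h - h')) i := by
  simp only [actionValue, Pi.sub_apply, mulVec, dotProduct, mul_sub, Finset.sum_sub_distrib]
  ring

theorem actionValue_eq_sub_mul (A : Arm n) (lam : ℝ) (h : Fin n → ℝ) (a : Fin 2) (i : Fin n) :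
    A.actionValue lam h a i = A.actionValue 0 h a i - lam * ((a : ℕ) : ℝ) := by
  simp only [actionValue, reward]
  ring

theorem actionValue_add_mul_sub (A : Arm n) (lam : ℝ) (h h' : Fin n → ℝ) (a : Fin 2)
    (i : Fin n) :
    A.actionValue lam (fun j => h j + lam * (h' j - h j)) a i
      = A.actionValue 0 h a i + lam * (A.actionValue 1 h' a i - A.actionValue 0 h a i) := by
  simp only [actionValue, reward, mul_add, mul_sub, Finset.sum_add_distrib,
    Finset.sum_sub_distrib, Finset.mul_sum, mul_left_comm lam]
  ring

theorem actionValue_one_sub_zero_congr (hh : ∀ i j, (h - h') i = (h - h') j) (i : Fin n) :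
    A.actionValue lam h 1 i - A.actionValue lam h 0 i
      = A.actionValue lam h' 1 i - A.actionValue lam h' 0 i := by
  have hconst (a : Fin 2) : (A.P a *ᵥ (h - h')) i = (h - h') i := by
    rw [funext fun j => hh j i, mulVec_const_of_mem_rowStochastic (A.P_mem_rowStochastic a)]
  linarith [hconst 0, hconst 1, A.actionValue_sub_actionValue lam h h' 0 i,
    A.actionValue_sub_actionValue lam h h' 1 i]

theorem hasGain_of_evaluation {g : ℝ} (hg : ∀ i, g + h i = A.actionValue lam h (act π i) i)
    (i : Fin n) : A.HasGain lam π i g :=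
  tendsto_average_of_poisson (A.trans_mem_rowStochastic π) hg i

/- The right-hand side minus `P h` is a reward that dominates the actual one and has average
`g`. -/
theorem HasGain.le_of_actionValue_le {g x : ℝ} (hx : A.HasGain lam π i x)
    (hg : ∀ i, A.actionValue lam h (act π i) i ≤ g + h i) : x ≤ g := by
  let v : Fin n → ℝ := fun j => g + h j - (A.trans π *ᵥ h) j
  have hv : (fun j => A.reward lam (act π j) j) ≤ v := fun j => le_sub_iff_add_le.2 (hg j)
  have hlim := tendsto_average_of_poisson (g := g) (v := v) (A.trans_mem_rowStochastic π)
    (fun j => (sub_add_cancel _ _).symm) i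
  refine le_of_tendsto_of_tendsto' hx hlim fun T => ?_
  gcongr with t
  exact mulVec_le_mulVec_of_mem_rowStochastic (pow_mem (A.trans_mem_rowStochastic π) t) hv i

theorem actionValue_le_max (A : Arm n) (lam : ℝ) (h : Fin n → ℝ) (a : Fin 2) (i : Fin n) :
    A.actionValue lam h a i ≤ max (A.actionValue lam h 0 i) (A.actionValue lam h 1 i) := by
  fin_cases a
  · exact le_max_left _ _
  · exact le_max_right _ _

theorem isOptimalGain_of_bellman {g : ℝ}
    (hB : ∀ i, g + h i = max (A.actionValue lam h 0 i) (A.actionValue lam h 1 i))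
    (hπ : ∀ i, A.actionValue lam h (act π i) i
      = max (A.actionValue lam h 0 i) (A.actionValue lam h 1 i)) : A.IsOptimalGain lam g := by
  refine fun i => ⟨⟨π, hasGain_of_evaluation (fun j => (hB j).trans (hπ j).symm) i⟩, ?_⟩
  rintro x ⟨ρ, hx⟩
  exact hx.le_of_actionValue_le fun j => (A.actionValue_le_max lam h _ j).trans_eq (hB j).symm

theorem adv_eq_actionValue_sub (A : Arm n) (π : Finset (Fin n)) (i : Fin n) (lam : ℝ) :
    A.adv π i lam
      = A.actionValue lam (A.bias π lam) 1 i - A.actionValue lam (A.bias π lam) 0 i := by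
  simp only [adv, actionValue, reward, sub_mul, Finset.sum_sub_distrib, Fin.val_one,
    Fin.val_zero, Nat.cast_one, Nat.cast_zero]
  ring

namespace UnichainPolicy

theorem isBias_bias (hπ : A.UnichainPolicy π) (lam : ℝ) : A.IsBias lam π (A.bias π lam) :=
  have ⟨g, h, hh⟩ := exists_poisson (A.trans_mem_rowStochastic π) hπ
    fun i => A.reward lam (act π i) i
  Classical.epsilon_spec (p := A.IsBias lam π) ⟨h, g, hh⟩

theorem adv_eq_of_isBias (hπ : A.UnichainPolicy π) (hh : A.IsBias lam π h) (i : Fin n) :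
    A.adv π i lam = A.actionValue lam h 1 i - A.actionValue lam h 0 i := by
  obtain ⟨g, hg⟩ := hπ.isBias_bias lam
  obtain ⟨g', hg'⟩ := hh
  have hsub (i : Fin n) :
      (g - g') + (A.bias π lam - h) i = (A.trans π *ᵥ (A.bias π lam - h)) i := by
    rw [trans_mulVec_apply, ← A.actionValue_sub_actionValue lam, ← hg i, ← hg' i, Pi.sub_apply]
    ring
  rw [adv_eq_actionValue_sub]
  exact actionValue_one_sub_zero_congr
    (eq_zero_and_const_of_add_eq_mulVec (A.trans_mem_rowStochastic π) hπ hsub).2 i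

theorem adv_eq_affine (hπ : A.UnichainPolicy π) (i : Fin n) (lam : ℝ) :
    A.adv π i lam = A.adv π i 0 + lam * (A.adv π i 1 - A.adv π i 0) := by
  obtain ⟨g, hg⟩ := hπ.isBias_bias 0
  obtain ⟨g', hg'⟩ := hπ.isBias_bias 1
  have hbias : A.IsBias lam π
      fun j => A.bias π 0 j + lam * (A.bias π 1 j - A.bias π 0 j) := by
    refine ⟨g + lam * (g' - g), fun i => ?_⟩
    rw [actionValue_add_mul_sub, ← hg i, ← hg' i]
    ring
  rw [hπ.adv_eq_of_isBias hbias, adv_eq_actionValue_sub, adv_eq_actionValue_sub,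
    actionValue_add_mul_sub, actionValue_add_mul_sub]
  ring

theorem continuous_adv (hπ : A.UnichainPolicy π) (i : Fin n) : Continuous (A.adv π i) := by
  rw [funext (hπ.adv_eq_affine i)]
  fun_prop

theorem adv_neg_of_mem_Ioc (hπ : A.UnichainPolicy π) (hμ : A.adv π i μ ≤ 0)
    (hν : A.adv π i ν < 0) (hlam : lam ∈ Ioc μ ν) : A.adv π i lam < 0 := by
  have hconv : (ν - μ) * A.adv π i lam
      = (ν - lam) * A.adv π i μ + (lam - μ) * A.adv π i ν := by
    rw [hπ.adv_eq_affine i lam, hπ.adv_eq_affine i μ, hπ.adv_eq_affine i ν]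
    ring
  have hneg : (ν - μ) * A.adv π i lam < 0 := hconv ▸ add_neg_of_nonpos_of_neg
    (mul_nonpos_of_nonneg_of_nonpos (sub_nonneg.2 hlam.2) hμ)
    (mul_neg_of_pos_of_neg (sub_pos.2 hlam.1) hν)
  exact neg_of_mul_neg_right hneg (sub_nonneg.2 (hlam.1.le.trans hlam.2))

theorem exists_adv_eq_zero (hπ : A.UnichainPolicy π) (hle : μ ≤ lam) (hμ : 0 ≤ A.adv π i μ)
    (hlam : A.adv π i lam ≤ 0) : ∃ y ∈ Icc μ lam, A.adv π i y = 0 :=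
  intermediate_value_Icc' hle (hπ.continuous_adv i).continuousOn ⟨hlam, hμ⟩

/- Under a policy that takes the same action everywhere, the penalty is a constant added to all
rewards, so one bias vector serves for all penalties. -/
theorem adv_eq_sub_of_act_eq (hπ : A.UnichainPolicy π) {a : Fin 2} (ha : ∀ i, act π i = a)
    (i : Fin n) (lam : ℝ) : A.adv π i lam = A.adv π i 0 - lam := by
  obtain ⟨g, hg⟩ := hπ.isBias_bias 0
  have hbias : A.IsBias lam π (A.bias π 0) := by
    refine ⟨g - lam * ((a : ℕ) : ℝ), fun i => ?_⟩
    rw [actionValue_eq_sub_mul, ← hg i, ha]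
    ring
  rw [hπ.adv_eq_of_isBias hbias, adv_eq_actionValue_sub, A.actionValue_eq_sub_mul lam _ 1,
    A.actionValue_eq_sub_mul lam _ 0, Fin.val_one, Fin.val_zero, Nat.cast_one, Nat.cast_zero]
  ring

theorem adv_univ (hu : A.UnichainPolicy Finset.univ) (i : Fin n) (lam : ℝ) :
    A.adv Finset.univ i lam = A.adv Finset.univ i 0 - lam :=
  hu.adv_eq_sub_of_act_eq (fun j => act_of_mem (Finset.mem_univ j)) i lam

theorem adv_empty (he : A.UnichainPolicy ∅) (i : Fin n) (lam : ℝ) :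
    A.adv ∅ i lam = A.adv ∅ i 0 - lam :=
  he.adv_eq_sub_of_act_eq (fun j => act_of_notMem (Finset.notMem_empty j)) i lam

theorem eventually_adv_univ_pos (hu : A.UnichainPolicy Finset.univ) :
    ∀ᶠ lam in Filter.atBot, ∀ i, 0 < A.adv Finset.univ i lam := by
  refine Filter.eventually_all.2 fun i => ?_
  filter_upwards [Filter.eventually_lt_atBot (A.adv Finset.univ i 0)] with lam hlam
  rwa [hu.adv_univ, sub_pos]

theorem eventually_adv_empty_neg (he : A.UnichainPolicy ∅) :
    ∀ᶠ lam in Filter.atTop, ∀ i, A.adv ∅ i lam < 0 := by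
  refine Filter.eventually_all.2 fun i => ?_
  filter_upwards [Filter.eventually_gt_atTop (A.adv ∅ i 0)] with lam hlam
  rwa [he.adv_empty, sub_neg]

end UnichainPolicy

theorem Unichain.adv_eq_adv (hA : A.Unichain)
    (hs : ∀ i, ¬ (i ∈ π ↔ i ∈ ρ) → A.adv π i lam * A.adv ρ i lam ≤ 0) (i : Fin n) :
    A.adv π i lam = A.adv ρ i lam := by
  obtain ⟨g, hg⟩ := (hA π).isBias_bias lam
  obtain ⟨g', hg'⟩ := (hA ρ).isBias_bias lam
  have key (i : Fin n) :
      (∃ a, (g - g') + (A.bias π lam - A.bias ρ lam) i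
        ≤ (A.P a *ᵥ (A.bias π lam - A.bias ρ lam)) i) ∧
      ∃ a, (A.P a *ᵥ (A.bias π lam - A.bias ρ lam)) i
        ≤ (g - g') + (A.bias π lam - A.bias ρ lam) i := by
    have hπ := hg i
    have hρ := hg' i
    have hadvπ := A.adv_eq_actionValue_sub π i lam
    have hadvρ := A.adv_eq_actionValue_sub ρ i lam
    simp only [← A.actionValue_sub_actionValue lam, Pi.sub_apply]
    by_cases hact : i ∈ π ↔ i ∈ ρ
    · have heq : act π i = act ρ i := if_congr hact rfl rfl
      rw [heq] at hπ
      exact ⟨⟨act ρ i, by linarith⟩, ⟨act ρ i, by linarith⟩⟩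
    have hopp := mul_nonpos_iff.1 (hs i hact)
    by_cases hiπ : i ∈ π
    · rw [act_of_mem hiπ] at hπ
      rw [act_of_notMem (by tauto)] at hρ
      rcases hopp with hopp | hopp
      · exact ⟨⟨1, by linarith⟩, ⟨0, by linarith⟩⟩
      · exact ⟨⟨0, by linarith⟩, ⟨1, by linarith⟩⟩
    · rw [act_of_notMem hiπ] at hπ
      rw [act_of_mem (by tauto)] at hρ
      rcases hopp with hopp | hopp
      · exact ⟨⟨1, by linarith⟩, ⟨0, by linarith⟩⟩
      · exact ⟨⟨0, by linarith⟩, ⟨1, by linarith⟩⟩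
  rw [adv_eq_actionValue_sub, adv_eq_actionValue_sub]
  exact actionValue_one_sub_zero_congr
    (hA.const_of_add_le_of_le_add (fun i => (key i).1) fun i => (key i).2) i

/-- The action of the policy `π` in state `i` is optimal, for the penalty `lam`, against a bias
vector of `π`. -/
def GreedyAt (A : Arm n) (lam : ℝ) (π : Finset (Fin n)) (i : Fin n) : Prop :=
  (i ∈ π → 0 ≤ A.adv π i lam) ∧ (i ∉ π → A.adv π i lam ≤ 0)

/-- No change of action in any state improves on the policy `π` for the penalty `lam`. -/
def Greedy (A : Arm n) (lam : ℝ) (π : Finset (Fin n)) : Prop :=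
  ∀ i, A.GreedyAt lam π i

theorem GreedyAt.adv_mul_adv_nonpos (hπ : A.GreedyAt lam π i) (hρ : A.GreedyAt lam ρ i)
    (hi : ¬ (i ∈ π ↔ i ∈ ρ)) : A.adv π i lam * A.adv ρ i lam ≤ 0 := by
  by_cases hiπ : i ∈ π
  · exact mul_nonpos_of_nonneg_of_nonpos (hπ.1 hiπ) (hρ.2 (by tauto))
  · exact mul_nonpos_of_nonpos_of_nonneg (hπ.2 hiπ) (hρ.1 (by tauto))

theorem UnichainPolicy.greedyAt_iff (hπ : A.UnichainPolicy π) (hh : A.IsBias lam π h) :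
    A.GreedyAt lam π i ↔ A.actionValue lam h (act π i) i
      = max (A.actionValue lam h 0 i) (A.actionValue lam h 1 i) := by
  rw [GreedyAt, hπ.adv_eq_of_isBias hh]
  by_cases hi : i ∈ π
  · simp [hi, act_of_mem]
  · simp [hi, act_of_notMem]

theorem UnichainPolicy.bellmanOptimal_iff_greedy (hπ : A.UnichainPolicy π) :
    A.BellmanOptimal lam π ↔ A.Greedy lam π := by
  constructor
  · rintro ⟨g, h, -, hB, hmax⟩ i
    exact (hπ.greedyAt_iff ⟨g, fun j => (hB j).trans (hmax j).symm⟩).2 (hmax i)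
  · intro hG
    obtain ⟨g, hg⟩ := hπ.isBias_bias lam
    have hmax (i : Fin n) := (hπ.greedyAt_iff ⟨g, hg⟩).1 (hG i)
    have hB (i : Fin n) := (hg i).trans (hmax i)
    exact ⟨g, A.bias π lam, isOptimalGain_of_bellman hB hmax, hB, hmax⟩

theorem Unichain.greedyAt_or_greedyAt (hA : A.Unichain) (hsπ : s ∈ π) (hsρ : s ∉ ρ)
    (h : ∀ i ≠ s, (i ∈ π ↔ i ∈ ρ) ∨ (A.GreedyAt lam π i ∧ A.GreedyAt lam ρ i)) :
    A.GreedyAt lam π s ∨ A.GreedyAt lam ρ s := by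
  by_contra! hnot
  have hπ : A.adv π s lam < 0 := by
    by_contra! hc
    exact hnot.1 ⟨fun _ => hc, fun hs => absurd hsπ hs⟩
  have hρ : 0 < A.adv ρ s lam := by
    by_contra! hc
    exact hnot.2 ⟨fun hs => absurd hs hsρ, fun _ => hc⟩
  have heq : A.adv π s lam = A.adv ρ s lam := hA.adv_eq_adv (fun i hi => by
    rcases eq_or_ne i s with rfl | his
    · exact mul_nonpos_of_nonpos_of_nonneg hπ.le hρ.le
    · obtain ⟨hiπ, hiρ⟩ := (h i his).resolve_left hi
      exact hiπ.adv_mul_adv_nonpos hiρ hi) s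
  linarith

theorem Unichain.exists_forall_greedyAt (hA : A.Unichain) (lam : ℝ) (F π : Finset (Fin n)) :
    ∃ ρ, (∀ i ∈ F, A.GreedyAt lam ρ i) ∧ ∀ i ∉ F, (i ∈ ρ ↔ i ∈ π) := by
  induction F using Finset.induction_on generalizing π with
  | empty => exact ⟨π, by simp, by simp⟩
  | insert s F hs ih =>
    obtain ⟨ρ₁, hG₁, hρ₁⟩ := ih (insert s π)
    obtain ⟨ρ₀, hG₀, hρ₀⟩ := ih (π.erase s)
    have hoff₁ : ∀ i ∉ insert s F, (i ∈ ρ₁ ↔ i ∈ π) := by grind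
    have hoff₀ : ∀ i ∉ insert s F, (i ∈ ρ₀ ↔ i ∈ π) := by grind
    have hor : A.GreedyAt lam ρ₁ s ∨ A.GreedyAt lam ρ₀ s := by
      refine hA.greedyAt_or_greedyAt ((hρ₁ s hs).2 (by simp)) (by simp [hρ₀ s hs]) fun i his => ?_
      by_cases hi : i ∈ F
      · exact .inr ⟨hG₁ i hi, hG₀ i hi⟩
      · have hi' : i ∉ insert s F := by simp [his, hi]
        exact .inl ((hoff₁ i hi').trans (hoff₀ i hi').symm)
    rcases hor with h₁ | h₀
    · exact ⟨ρ₁, (Finset.forall_mem_insert _ _ _).2 ⟨h₁, hG₁⟩, hoff₁⟩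
    · exact ⟨ρ₀, (Finset.forall_mem_insert _ _ _).2 ⟨h₀, hG₀⟩, hoff₀⟩

theorem Unichain.exists_greedy (hA : A.Unichain) (lam : ℝ) : ∃ π, A.Greedy lam π :=
  have ⟨ρ, hρ, _⟩ := hA.exists_forall_greedyAt lam Finset.univ ∅
  ⟨ρ, fun i => hρ i (Finset.mem_univ i)⟩

theorem Greedy.adv_eq_adv (hA : A.Unichain) (hπ : A.Greedy lam π) (hρ : A.Greedy lam ρ)
    (i : Fin n) : A.adv π i lam = A.adv ρ i lam :=
  hA.adv_eq_adv (fun j => (hπ j).adv_mul_adv_nonpos (hρ j)) i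

theorem Greedy.of_adv_eq_zero (hA : A.Unichain) (hπ : A.Greedy lam π)
    (h : ∀ i, ¬ (i ∈ π ↔ i ∈ ρ) → A.adv π i lam = 0) : A.Greedy lam ρ := by
  intro i
  have heq : A.adv π i lam = A.adv ρ i lam :=
    hA.adv_eq_adv (fun j hj => by rw [h j hj, zero_mul]) i
  rw [GreedyAt, ← heq]
  by_cases hi : i ∈ π ↔ i ∈ ρ
  · exact ⟨fun hiρ => (hπ i).1 (hi.2 hiρ), fun hiρ => (hπ i).2 (hi.not.2 hiρ)⟩
  · exact ⟨fun _ => (h i hi).ge, fun _ => (h i hi).le⟩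

theorem Greedy.erase (hA : A.Unichain) (hπ : A.Greedy lam π) (hs : A.adv π s lam ≤ 0) :
    A.Greedy lam (π.erase s) := by
  refine hπ.of_adv_eq_zero hA fun i hi => ?_
  obtain ⟨rfl, hiπ⟩ : i = s ∧ i ∈ π := by grind
  exact hs.antisymm ((hπ i).1 hiπ)

theorem Greedy.insert (hA : A.Unichain) (hπ : A.Greedy lam π) (hs : 0 ≤ A.adv π s lam) :
    A.Greedy lam (insert s π) := by
  refine hπ.of_adv_eq_zero hA fun i hi => ?_
  obtain ⟨rfl, hiπ⟩ : i = s ∧ i ∉ π := by grind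
  exact ((hπ i).2 hiπ).antisymm hs

/-- The optimal active advantage of state `i`: its active advantage under an optimal policy. All
optimal policies of a unichain arm give the same value, see `Greedy.adv_eq_adv`. -/
noncomputable def optAdv (A : Arm n) (i : Fin n) (lam : ℝ) : ℝ :=
  A.adv (Classical.epsilon fun π => A.Greedy lam π) i lam

theorem Greedy.adv_eq_optAdv (hA : A.Unichain) (hπ : A.Greedy lam π) (i : Fin n) :
    A.adv π i lam = A.optAdv i lam :=
  hπ.adv_eq_adv hA (Classical.epsilon_spec (p := fun π => A.Greedy lam π) ⟨π, hπ⟩) i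

theorem Unichain.optAdv_nonneg_iff (hA : A.Unichain) :
    0 ≤ A.optAdv i lam ↔ ∃ π, A.Greedy lam π ∧ i ∈ π := by
  constructor
  · intro h
    obtain ⟨π, hπ⟩ := hA.exists_greedy lam
    rw [← hπ.adv_eq_optAdv hA] at h
    exact ⟨insert i π, hπ.insert hA h, Finset.mem_insert_self i π⟩
  · rintro ⟨π, hπ, hi⟩
    exact hπ.adv_eq_optAdv hA i ▸ (hπ i).1 hi

theorem Unichain.optAdv_pos_iff (hA : A.Unichain) :
    0 < A.optAdv i lam ↔ ∀ π, A.Greedy lam π → i ∈ π := by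
  constructor
  · intro h π hπ
    rw [← hπ.adv_eq_optAdv hA] at h
    by_contra hi
    exact h.not_ge ((hπ i).2 hi)
  · intro h
    obtain ⟨π, hπ⟩ := hA.exists_greedy lam
    by_contra! hneg
    rw [← hπ.adv_eq_optAdv hA] at hneg
    exact Finset.notMem_erase i π (h _ (hπ.erase hA hneg))

theorem Unichain.indexable_iff (hA : A.Unichain) :
    A.Indexable ↔
      ∀ i (lam lam' : ℝ), lam < lam' → 0 ≤ A.optAdv i lam' → 0 < A.optAdv i lam := by
  simp only [hA.optAdv_nonneg_iff, hA.optAdv_pos_iff, Indexable,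
    fun lam π => (hA π).bellmanOptimal_iff_greedy (lam := lam)]
  constructor
  · rintro h i lam lam' hlt ⟨π', hπ', hi⟩ π hπ
    exact h lam lam' hlt π π' hπ hπ' hi
  · intro h lam lam' hlt π π' hπ hπ' i hi
    exact h i lam lam' hlt ⟨π', hπ', hi⟩ π hπ

/-- The candidates for the next penalty: the penalties from `μ` on at which the active advantage
of some active state vanishes. -/
def advZeros (A : Arm n) (π : Finset (Fin n)) (μ : EReal) : Set ℝ :=
  {lam | μ ≤ lam ∧ ∃ i ∈ π, A.adv π i lam = 0}

theorem nextPenalty_eq_of_isLeast {μ : EReal} (hν : IsLeast (A.advZeros π μ) ν) :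
    A.nextPenalty π μ = ν :=
  IsLeast.csInf_eq ⟨⟨ν, rfl, hν.1⟩, by
    rintro x ⟨lam, rfl, hlam⟩
    exact EReal.coe_le_coe (hν.2 hlam)⟩

theorem Unichain.isClosed_advZeros (hA : A.Unichain) (π : Finset (Fin n)) (μ : ℝ) :
    IsClosed (A.advZeros π μ) := by
  have h : A.advZeros π μ = Ici μ ∩ ⋃ i ∈ π, {lam | A.adv π i lam = 0} := by
    ext lam
    simp [advZeros]
  rw [h]
  exact isClosed_Ici.inter <| π.finite_toSet.isClosed_biUnion fun i _ =>
    isClosed_eq ((hA π).continuous_adv i) continuous_const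

/- Otherwise the active advantages of all active states stay nonnegative, whereas those under the
policy of permanent rest are eventually negative; the two policies differ only in the former
states. -/
theorem Unichain.advZeros_nonempty (hA : A.Unichain) (hne : π.Nonempty)
    (hμ : ∀ i ∈ π, 0 ≤ A.adv π i μ) : (A.advZeros π μ).Nonempty := by
  by_contra! hempty
  obtain ⟨lam, hneg, hle⟩ :=
    ((hA ∅).eventually_adv_empty_neg.and (Filter.eventually_ge_atTop μ)).exists
  have hpos : ∀ i ∈ π, 0 < A.adv π i lam := fun i hi => by
    by_contra! hc
    obtain ⟨y, hy, hy0⟩ := (hA π).exists_adv_eq_zero hle (hμ i hi) hc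
    exact hempty.le ⟨EReal.coe_le_coe hy.1, i, hi, hy0⟩
  obtain ⟨i, hi⟩ := hne
  have heq : A.adv π i lam = A.adv ∅ i lam := hA.adv_eq_adv (fun j hj =>
    mul_nonpos_of_nonneg_of_nonpos (hpos j (by simpa using hj)).le (hneg j).le) i
  linarith [hpos i hi, hneg i]

theorem Unichain.exists_isLeast_advZeros (hA : A.Unichain) (hne : π.Nonempty)
    (hμ : ∀ i ∈ π, 0 ≤ A.adv π i μ) : ∃ ν, IsLeast (A.advZeros π μ) ν :=
  ⟨_, (hA.isClosed_advZeros π μ).isLeast_csInf (hA.advZeros_nonempty hne hμ)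
    ⟨μ, fun _ hlam => EReal.coe_le_coe_iff.1 hlam.1⟩⟩

theorem UnichainPolicy.adv_nonneg_of_isLeast (hπ : A.UnichainPolicy π) (hi : i ∈ π)
    (hμ : 0 ≤ A.adv π i μ) (hν : IsLeast (A.advZeros π μ) ν) (hlam : lam ∈ Icc μ ν) :
    0 ≤ A.adv π i lam := by
  by_contra! hneg
  obtain ⟨y, hy, hy0⟩ := hπ.exists_adv_eq_zero hlam.1 hμ hneg.le
  have hνy : ν ≤ y := hν.2 ⟨EReal.coe_le_coe hy.1, i, hi, hy0⟩
  obtain rfl : y = lam := hy.2.antisymm (hlam.2.trans hνy)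
  exact hneg.ne hy0

theorem UnichainPolicy.adv_pos_of_isLeast (hπ : A.UnichainPolicy π) (hi : i ∈ π)
    (hμ : 0 ≤ A.adv π i μ) (hν : IsLeast (A.advZeros π μ) ν) (hlam : lam ∈ Ico μ ν) :
    0 < A.adv π i lam :=
  (hπ.adv_nonneg_of_isLeast hi hμ hν (Ico_subset_Icc_self hlam)).lt_of_ne' fun h0 =>
    hlam.2.not_ge (hν.2 ⟨EReal.coe_le_coe hlam.1, i, hi, h0⟩)

/-- Up to the penalty `μ`, the optimal active advantage of state `i` is that of an indexable
state with index `l`: it crosses zero exactly once, downwards and at `l`. -/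
structure IsIndexUpTo (A : Arm n) (i : Fin n) (l μ : ℝ) : Prop where
  le : l ≤ μ
  zero : A.optAdv i l = 0
  pos : ∀ lam < l, 0 < A.optAdv i lam
  neg : ∀ lam ∈ Ioc l μ, A.optAdv i lam < 0

theorem IsIndexUpTo.extend {l : ℝ} (hl : A.IsIndexUpTo i l μ) (hle : μ ≤ ν)
    (hneg : ∀ lam ∈ Ioc μ ν, A.optAdv i lam < 0) : A.IsIndexUpTo i l ν where
  le := hl.le.trans hle
  zero := hl.zero
  pos := hl.pos
  neg lam hlam := (le_or_gt lam μ).elim (fun h => hl.neg lam ⟨hlam.1, h⟩)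
    fun h => hneg lam ⟨h, hlam.2⟩

/-- The invariant of the main loop: the policy `π` is optimal for the penalty `μ`, its states are
strictly active below `μ`, and every other state has an index as far as the penalties up to `μ`
can tell. -/
structure LoopInvariant (A : Arm n) (π : Finset (Fin n)) (μ : ℝ) : Prop where
  greedy : A.Greedy μ π
  active : ∀ i ∈ π, ∀ lam < μ, 0 < A.optAdv i lam
  passive : ∀ i ∉ π, ∃ l, A.IsIndexUpTo i l μ

theorem Unichain.loopInvariant_univ (hA : A.Unichain)
    (hpos : ∀ lam ≤ μ, ∀ i, 0 < A.adv Finset.univ i lam) :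
    A.LoopInvariant Finset.univ μ := by
  have hG {lam : ℝ} (hlam : lam ≤ μ) : A.Greedy lam Finset.univ := fun i =>
    ⟨fun _ => (hpos lam hlam i).le, fun hi => absurd (Finset.mem_univ i) hi⟩
  refine ⟨hG le_rfl, fun i _ lam hlam => ?_, fun i hi => absurd (Finset.mem_univ i) hi⟩
  rw [← (hG hlam.le).adv_eq_optAdv hA]
  exact hpos lam hlam.le i

namespace LoopInvariant

theorem indexable (hA : A.Unichain) (hI : A.LoopInvariant ∅ μ) : A.Indexable := by
  rw [hA.indexable_iff]
  intro i lam lam' hlt hnonneg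
  obtain ⟨l, hl⟩ := hI.passive i (Finset.notMem_empty i)
  refine hl.pos lam (hlt.trans_le ?_)
  by_contra! hgt
  rcases le_or_gt lam' μ with hle | hμ
  · exact (hl.neg lam' ⟨hgt, hle⟩).not_ge hnonneg
  have hneg (j : Fin n) : A.adv ∅ j lam' < 0 := by
    have hj := (hI.greedy j).2 (Finset.notMem_empty j)
    rw [(hA ∅).adv_empty] at hj ⊢
    linarith
  have hG : A.Greedy lam' ∅ := fun j =>
    ⟨fun hj => absurd hj (Finset.notMem_empty j), fun _ => (hneg j).le⟩
  exact (hG.adv_eq_optAdv hA i ▸ hneg i).not_ge hnonneg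

/- In an indexable arm the states outside `π`, having crossed zero before `ν`, are strictly
passive at `ν`, so `π` only errs by keeping too many states active; but then its advantages agree
with those of the optimal policies. -/
theorem not_indexable (hA : A.Unichain) (hI : A.LoopInvariant π μ)
    (hν : IsLeast (A.advZeros π μ) ν) (hlt : μ < ν) {j : Fin n} (hj : j ∉ π)
    (hjν : 0 ≤ A.adv π j ν) : ¬ A.Indexable := by
  rw [hA.indexable_iff]
  intro hind
  have hneg : ∀ i ∉ π, A.optAdv i ν < 0 := fun i hi => by
    obtain ⟨l, hl⟩ := hI.passive i hi
    by_contra! hc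
    exact (hind i l ν (hl.le.trans_lt hlt) hc).ne' hl.zero
  obtain ⟨ρ, hρ⟩ := hA.exists_greedy ν
  have hsub : ρ ⊆ π := fun i hi => by
    by_contra hc
    exact (hρ.adv_eq_optAdv hA i ▸ hneg i hc).not_ge ((hρ i).1 hi)
  have heq : A.adv π j ν = A.adv ρ j ν := hA.adv_eq_adv (fun i hi => by
    have hiπ : i ∈ π := by grind
    have hiρ : i ∉ ρ := by grind
    exact mul_nonpos_of_nonneg_of_nonpos
      ((hA π).adv_nonneg_of_isLeast hiπ ((hI.greedy i).1 hiπ) hν ⟨hlt.le, le_rfl⟩)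
      ((hρ i).2 hiρ)) j
  rw [heq, hρ.adv_eq_optAdv hA] at hjν
  exact (hneg j hj).not_ge hjν

theorem adv_neg (hA : A.Unichain) (hI : A.LoopInvariant π μ)
    (htest : μ < ν → ∀ i ∉ π, A.adv π i ν < 0) (hi : i ∉ π) (hlam : lam ∈ Ioc μ ν) :
    A.adv π i lam < 0 :=
  (hA π).adv_neg_of_mem_Ioc ((hI.greedy i).2 hi) (htest (hlam.1.trans_le hlam.2) i hi) hlam

theorem greedy_of_mem_Icc (hA : A.Unichain) (hI : A.LoopInvariant π μ)
    (hν : IsLeast (A.advZeros π μ) ν) (htest : μ < ν → ∀ i ∉ π, A.adv π i ν < 0)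
    (hlam : lam ∈ Icc μ ν) : A.Greedy lam π := by
  refine fun i => ⟨fun hi => ?_, fun hi => ?_⟩
  · exact (hA π).adv_nonneg_of_isLeast hi ((hI.greedy i).1 hi) hν hlam
  · rcases hlam.1.eq_or_lt with rfl | hlt
    · exact (hI.greedy i).2 hi
    · exact (hI.adv_neg hA htest hi ⟨hlt, hlam.2⟩).le

theorem optAdv_pos (hA : A.Unichain) (hI : A.LoopInvariant π μ)
    (hν : IsLeast (A.advZeros π μ) ν) (htest : μ < ν → ∀ i ∉ π, A.adv π i ν < 0)
    (hi : i ∈ π) (hlam : lam < ν) : 0 < A.optAdv i lam := by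
  rcases lt_or_ge lam μ with hlt | hge
  · exact hI.active i hi lam hlt
  · rw [← (hI.greedy_of_mem_Icc hA hν htest ⟨hge, hlam.le⟩).adv_eq_optAdv hA]
    exact (hA π).adv_pos_of_isLeast hi ((hI.greedy i).1 hi) hν ⟨hge, hlam⟩

theorem erase (hA : A.Unichain) (hI : A.LoopInvariant π μ) (hν : IsLeast (A.advZeros π μ) ν)
    (htest : μ < ν → ∀ i ∉ π, A.adv π i ν < 0) (hs : s ∈ π) (hs0 : A.adv π s ν = 0) :
    A.LoopInvariant (π.erase s) ν := by
  have hle : μ ≤ ν := EReal.coe_le_coe_iff.1 hν.1.1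
  have hG := hI.greedy_of_mem_Icc hA hν htest (right_mem_Icc.2 hle)
  refine ⟨hG.erase hA hs0.le, fun i hi lam hlam => ?_, fun i hi => ?_⟩
  · exact hI.optAdv_pos hA hν htest (Finset.mem_of_mem_erase hi) hlam
  · rcases eq_or_ne i s with rfl | his
    · exact ⟨ν, le_rfl, hG.adv_eq_optAdv hA i ▸ hs0,
        fun lam hlam => hI.optAdv_pos hA hν htest hs hlam,
        fun lam hlam => absurd hlam.2 hlam.1.not_ge⟩
    · have hiπ : i ∉ π := fun hc => hi (Finset.mem_erase.2 ⟨his, hc⟩)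
      obtain ⟨l, hl⟩ := hI.passive i hiπ
      refine ⟨l, hl.extend hle fun lam hlam => ?_⟩
      rw [← (hI.greedy_of_mem_Icc hA hν htest (Ioc_subset_Icc_self hlam)).adv_eq_optAdv hA]
      exact hI.adv_neg hA htest hiπ hlam

end LoopInvariant

/-- The output is a correct decision on the indexability of the unichain arm `A`. -/
def Output.Decides (A : Arm n) : Output n → Prop
  | .multichain => False
  | .notIndexable => ¬ A.Indexable
  | .indexable _ => A.Indexable

theorem Output.Decides.exists_eq_indexable_iff {o : Output n} (ho : o.Decides A) :
    (∃ index, o = .indexable index) ↔ A.Indexable := by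
  cases o with
  | multichain => exact ho.elim
  | notIndexable => exact iff_of_false (fun ⟨_, h⟩ => nomatch h) ho
  | indexable index => exact iff_of_true ⟨index, rfl⟩ ho

theorem Output.Decides.ne_multichain {o : Output n} (ho : o.Decides A) : o ≠ .multichain := by
  rintro rfl
  exact ho

open Classical in
theorem Unichain.loop_succ (hA : A.Unichain) {μ : EReal} (hν : IsLeast (A.advZeros π μ) ν)
    (choice : Finset (Fin n) → Fin n) (m : ℕ) (index : Fin n → EReal) :
    A.loop choice (m + 1) π μ index =
      if μ < ν ∧ ∃ i, i ∉ π ∧ 0 ≤ A.adv π i ν then .notIndexable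
      else A.loop choice m (π.erase (choice (π.filter fun i => A.adv π i ν = 0))) ν
        (Function.update index (choice (π.filter fun i => A.adv π i ν = 0)) ν) := by
  have hadvE (i : Fin n) : A.advE π i ν = (A.adv π i ν : EReal) := rfl
  simp only [loop, nextPenalty_eq_of_isLeast hν, hadvE, EReal.coe_nonneg, EReal.coe_eq_zero,
    EReal.coe_ne_top, if_false, hA _, not_true_eq_false]

theorem LoopInvariant.decides_loop {choice : Finset (Fin n) → Fin n} (hA : A.Unichain)
    (hchoice : ∀ s : Finset (Fin n), s.Nonempty → choice s ∈ s) (hI : A.LoopInvariant π μ)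
    (index : Fin n → EReal) : (A.loop choice π.card π μ index).Decides A := by
  classical
  induction hm : π.card generalizing π μ index with
  | zero =>
    obtain rfl := Finset.card_eq_zero.1 hm
    exact hI.indexable hA
  | succ m ih =>
    obtain ⟨ν, hν⟩ := hA.exists_isLeast_advZeros (Finset.card_pos.1 (hm ▸ m.succ_pos))
      fun i hi => (hI.greedy i).1 hi
    rw [hA.loop_succ hν]
    split_ifs with htest
    · obtain ⟨hlt, j, hj, hjν⟩ := htest
      exact hI.not_indexable hA hν (EReal.coe_lt_coe_iff.1 hlt) hj hjν
    · obtain ⟨z, hz, hz0⟩ := hν.1.2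
      have hσ := hchoice (π.filter fun i => A.adv π i ν = 0)
        ⟨z, Finset.mem_filter.2 ⟨hz, hz0⟩⟩
      rw [Finset.mem_filter] at hσ
      refine ih (hI.erase hA hν (fun hlt i hi => ?_) hσ.1 hσ.2) _
        (by rw [Finset.card_erase_of_mem hσ.1, hm, Nat.add_sub_cancel])
      by_contra! hc
      exact htest ⟨EReal.coe_lt_coe hlt, i, hi, hc⟩

theorem advZeros_bot_eq (hpos : ∀ lam ≤ μ, ∀ i ∈ π, 0 < A.adv π i lam) :
    A.advZeros π ⊥ = A.advZeros π μ := by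
  ext lam
  refine ⟨fun ⟨_, i, hi, h0⟩ => ⟨?_, i, hi, h0⟩, fun h => ⟨bot_le, h.2⟩⟩
  by_contra! hc
  exact (hpos lam (EReal.coe_lt_coe_iff.1 hc).le i hi).ne' h0

theorem Unichain.decides_algorithm {choice : Finset (Fin n) → Fin n} (hA : A.Unichain)
    (hchoice : ∀ s : Finset (Fin n), s.Nonempty → choice s ∈ s) :
    (A.algorithm choice).Decides A := by
  obtain ⟨b, hb⟩ := Filter.eventually_atBot.1 (hA Finset.univ).eventually_adv_univ_pos
  have hI : A.LoopInvariant Finset.univ b := hA.loopInvariant_univ hb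
  have hloop : A.loop choice n Finset.univ ⊥ (fun _ => ⊥)
      = A.loop choice n Finset.univ b fun _ => ⊥ := by
    obtain ⟨m, rfl⟩ := Nat.exists_eq_succ_of_ne_zero (Fin.pos_iff_nonempty.2 hA.nonempty).ne'
    obtain ⟨ν, hν⟩ := hA.exists_isLeast_advZeros Finset.univ_nonempty
      fun i hi => (hI.greedy i).1 hi
    have hν' : IsLeast (A.advZeros Finset.univ ⊥) ν := by
      rwa [advZeros_bot_eq fun lam hlam i _ => hb lam hlam i]
    simp only [hA.loop_succ hν, hA.loop_succ hν', Finset.mem_univ, not_true_eq_false, false_and,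
      exists_false, and_false, if_false]
  rw [algorithm, if_neg (not_not.2 (hA _)), hloop]
  simpa only [Finset.card_univ, Fintype.card_fin] using hI.decides_loop hA hchoice fun _ => ⊥

end Arm

theorem corollary1 {n : ℕ} (A : Arm n) (hA : A.Unichain)
    (choice : Finset (Fin n) → Fin n)
    (hchoice : ∀ s : Finset (Fin n), s.Nonempty → choice s ∈ s) :
    ((∃ index : Fin n → EReal, A.algorithm choice = Arm.Output.indexable index) ↔
      A.Indexable) ∧
    A.algorithm choice ≠ Arm.Output.multichain :=
  have hdec := hA.decides_algorithm hchoice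
  ⟨hdec.exists_eq_indexable_iff, hdec.ne_multichain⟩
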